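/- Let $\mathcal H$ be a complex vector space with two inner products $(\cdot,\cdot)_0$, $(\cdot,\cdot)_1$, each of which makes it a Hilbert space; let $\|\cdot\|_0,\|\cdot\|_1$ be the two norms. For $i=0,1$ let $H_i$ be a densely defined nonnegative operator on $\mathcal H$ that is self-adjoint with respect to $(\cdot,\cdot)_i$, and let $Q_i$ be its quadratic form, $Q_i(u,u)=(H_iu,u)_i$ for $u\in\mathrm{Dom}(H_i)$. Let $\mathcal C\subset \mathrm{Dom}(H_0)\cap\mathrm{Dom}(H_1)$ be a common core: for $i=0,1$, $\mathcal C$ is dense in $\mathrm{Dom}(H_i)$ for the form norm $(\|u\|_i^2+Q_i(u,u))^{1/2}$ (hence dense in $\mathcal H$ for $\|\cdot\|_i$). Call $H_0,H_1$ $\varepsilon$-close if for all $u\in\mathcal C$ $$(1-\varepsilon)\|u\|_0^2\le\|u\|_1^2\le(1+\varepsilon)\|u\|_0^2,\qquad (1-\varepsilon)Q_0(u,u)\le Q_1(u,u)\le(1+\varepsilon)Q_0(u,u).$$ **Theorem.** (a) For every $A>0$ there is a constant $c(A)>0$, depending only on $A$, such that, whenever $H_0,H_1$ as above are $\varepsilon$-close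 with $0<\varepsilon<1/2$, every $\lambda\in\sigma(H_1)\cap[0,A]$ satisfies $$\operatorname{dist}(\lambda,\sigma(H_0))<c(A)\,\varepsilon^{1/3}.$$ (b) There is a function $\omega$ with $\omega(\varepsilon)\to0$ as $\varepsilon\to0^+$ such that, whenever $H_0,H_1$ as above are $\varepsilon$-close with $0<\varepsilon<1/2$, $$d_{GH}(\sigma(H_0),\sigma(H_1))\le\omega(\varepsilon).$$ Here $d_{GH}(\sigma(H_0),\sigma(H_1))$ is the pointed Gromov–Hausdorff distance of the pointed metric spaces $(\{-1\}\cup\sigma(H_i),-1)$, with the distance of $\mathbb R$: for pointed metric spaces $(X,x)$, $(Y,y)$ it is the infimum of all $r>0$ for which there are isometric embeddings of $X$ and $Y$ into one metric space such that the images of $x$ and $y$ have distance less than $r$, every point of $X$ at distance less than $1/r$ from $x$ has distance less than $r$ from a point of $Y$, and every point of $Y$ at distance less than $1/r$ from $y$ has distance less than $r$ from a point of $X$. -/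

import Mathlib

open Filter Topology

section Operators

variable {E : Type*} [NormedAddCommGroup E] [InnerProductSpace ℂ E]

/-- The diagonal values `Q(u, u) = (H u, u)`, for `u` in the domain of `H`, of the quadratic form of
the operator `H`. For a symmetric `H` the inner product `(H u, u)` is real. -/
noncomputable def quadForm (H : E →ₗ.[ℂ] E) (u : H.domain) : ℝ :=
  (inner ℂ (H u) (u : E)).re

/-- `H` is nonnegative: `(H u, u) ≥ 0` for all `u` in its domain. -/
def IsNonnegOperator (H : E →ₗ.[ℂ] E) : Prop :=
  ∀ u : H.domain, 0 ≤ quadForm H u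

/-- The spectrum of an unbounded operator `H`: the complex numbers `z` for which `H - z` does not
have an inverse that is an everywhere defined bounded operator `R`. -/
def operatorSpectrum (H : E →ₗ.[ℂ] E) : Set ℂ :=
  {z | ¬ ∃ R : E →L[ℂ] E,
    (∀ w : E, ∃ h : R w ∈ H.domain, H ⟨R w, h⟩ - z • R w = w) ∧
    ∀ u : H.domain, R (H u - z • (u : E)) = u}

/-- The subspace `C` of the domain of the nonnegative operator `H` is a core of `H` in the sense of
quadratic forms: it is dense in the domain of `H` (equivalently, in the form domain, in which the
domain of `H` is dense) for the form norm `(‖u‖² + Q(u, u))^(1/2)`. Every operator core, that is,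
every subspace of the domain that is dense in it for the graph norm, has this property; and such a
`C` is dense in `E` as soon as `H` is densely defined. -/
def IsFormCore (H : E →ₗ.[ℂ] E) (C : Submodule ℂ E) : Prop :=
  C ≤ H.domain ∧
    ∀ u : H.domain, ∀ δ : ℝ, 0 < δ →
      ∃ v : H.domain, (v : E) ∈ C ∧ ‖(u : E) - v‖ ^ 2 + quadForm H (u - v) < δ

end Operators

section Closeness

variable {E₀ E₁ : Type*} [NormedAddCommGroup E₀] [InnerProductSpace ℂ E₀] [CompleteSpace E₀]
  [NormedAddCommGroup E₁] [InnerProductSpace ℂ E₁] [CompleteSpace E₁]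

/-- The setting. A vector space with two Hilbert space inner products is presented as two Hilbert
spaces `E₀`, `E₁` with a linear bijection `J` that identifies their underlying vector spaces (no
continuity of `J` is assumed). `H₀` and `H₁` are nonnegative and self-adjoint, each for its own
inner product, and the subspace `C` (which is `C.map J` when it is viewed in `E₁`) is contained in
both domains and is a common core. -/
structure IsNonnegPair (J : E₀ ≃ₗ[ℂ] E₁) (C : Submodule ℂ E₀)
    (H₀ : E₀ →ₗ.[ℂ] E₀) (H₁ : E₁ →ₗ.[ℂ] E₁) : Prop where
  selfAdjoint₀ : IsSelfAdjoint H₀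
  selfAdjoint₁ : IsSelfAdjoint H₁
  nonneg₀ : IsNonnegOperator H₀
  nonneg₁ : IsNonnegOperator H₁
  core₀ : IsFormCore H₀ C
  core₁ : IsFormCore H₁ (C.map (J : E₀ →ₗ[ℂ] E₁))

/-- `ε`-closeness: on the common core `C` the two norms and the two quadratic forms agree up to
factors `1 ± ε`. In `form_le` and `le_form`, `u₀` and `u₁` are one vector of `C`, seen in the
domain of `H₀` and in that of `H₁`. -/
structure IsEpsClose (J : E₀ ≃ₗ[ℂ] E₁) (C : Submodule ℂ E₀)
    (H₀ : E₀ →ₗ.[ℂ] E₀) (H₁ : E₁ →ₗ.[ℂ] E₁) (ε : ℝ) : Prop where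
  le_norm : ∀ u ∈ C, (1 - ε) * ‖u‖ ^ 2 ≤ ‖J u‖ ^ 2
  norm_le : ∀ u ∈ C, ‖J u‖ ^ 2 ≤ (1 + ε) * ‖u‖ ^ 2
  le_form : ∀ (u₀ : H₀.domain) (u₁ : H₁.domain), (u₀ : E₀) ∈ C → J u₀ = u₁ →
    (1 - ε) * quadForm H₀ u₀ ≤ quadForm H₁ u₁
  form_le : ∀ (u₀ : H₀.domain) (u₁ : H₁.domain), (u₀ : E₀) ∈ C → J u₀ = u₁ →
    quadForm H₁ u₁ ≤ (1 + ε) * quadForm H₀ u₀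

end Closeness

section GromovHausdorff

universe u v

/-- The pointed metric spaces `(X, x)` and `(Y, y)` are `r`-near: they embed isometrically in one
metric space such that the images of `x` and `y` are less than `r` apart, and every point of one of
the balls `B(x, 1/r)`, `B(y, 1/r)` has distance less than `r` from a point of the other space. -/
def IsPointedGHNear (X : Type u) [MetricSpace X] (x : X) (Y : Type v) [MetricSpace Y] (y : Y)
    (r : ℝ) : Prop :=
  0 < r ∧ ∃ (Z : Type (max u v)) (_ : MetricSpace Z) (Φ : X → Z) (Ψ : Y → Z),
    Isometry Φ ∧ Isometry Ψ ∧ dist (Φ x) (Ψ y) < r ∧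
    (∀ a : X, dist a x < 1 / r → ∃ b : Y, dist (Φ a) (Ψ b) < r) ∧
    (∀ b : Y, dist b y < 1 / r → ∃ a : X, dist (Φ a) (Ψ b) < r)

/-- Gromov's pointed Gromov-Hausdorff distance. The set is bounded below by `0`, and it is nonempty:
gluing `X` and `Y` along `x` and `y` shows that any two pointed spaces are `1`-near. -/
noncomputable def pointedGHDist (X : Type u) [MetricSpace X] (x : X)
    (Y : Type v) [MetricSpace Y] (y : Y) : ℝ :=
  sInf {r : ℝ | IsPointedGHNear X x Y y r}

end GromovHausdorff

/-- The set `{-1} ∪ S`, with the distance of `ℂ`. For the spectrum `S` of a nonnegative self-adjoint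
operator this is a closed subset of the real line. -/
abbrev WithBasePoint (S : Set ℂ) : Type := ↥(insert (-1 : ℂ) S)

/-- The base point `-1` of `{-1} ∪ S`. -/
def basePoint (S : Set ℂ) : WithBasePoint S := ⟨-1, Set.mem_insert _ _⟩

/-- The pointed Gromov-Hausdorff distance between `({-1} ∪ S, -1)` and `({-1} ∪ T, -1)`. -/
noncomputable def spectralGHDist (S T : Set ℂ) : ℝ :=
  pointedGHDist (WithBasePoint S) (basePoint S) (WithBasePoint T) (basePoint T)

/-! ### Resolvents and spectra of unbounded self-adjoint operators. -/

section Resolvent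

open scoped ComplexConjugate LinearPMap

variable {E : Type*} [NormedAddCommGroup E] [InnerProductSpace ℂ E]

/-! Write a_i = Q_i + (·,·)_i for the form of H_i + 1, and m = 1 + λ. If λ ∈ σ(H₁), then H₁ has an
approximate eigenvector u in the core, in the weak sense that a₁(u, e) - m (u, e)₁ is small relative
to a₁(e, e)^(1/2). Closeness on the diagonal polarises, with no loss in the constant
(`abs_apply_le_of_diag_le`), so on the core both bilinear forms may be replaced by those of H₀; form
density then admits every e in Dom(H₀).

Let R = (H₀ + 1)⁻¹. Since (u, e)₀ = a₀(Ru, e), testing with e = u - mRu shows that u is an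
approximate eigenvector of the bounded self-adjoint operator R for the value 1/m. The functional
calculus gives a point μ ∈ σ(R) near 1/m, and μ⁻¹ - 1 ∈ σ(H₀) is near λ. The result,
`IsSymmClose.exists_mem_operatorSpectrum_near`, is an error of order ε(1 + λ)², linear in ε. Thus
(a) holds with room to spare; the cube root is used in (b), where the error must be at most r for
all 1 + λ ≤ 1/r. -/

/-- The linear map `u ↦ H u - z u` on the domain of `H`. -/
noncomputable def subScalar (H : E →ₗ.[ℂ] E) (z : ℂ) : H.domain →ₗ[ℂ] E :=
  H.toFun - z • H.domain.subtype

lemma subScalar_apply (H : E →ₗ.[ℂ] E) (z : ℂ) (u : H.domain) :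
    subScalar H z u = H u - z • (u : E) := rfl

lemma isClosed_range_subScalar [CompleteSpace E] {H : E →ₗ.[ℂ] E} (hH : IsSelfAdjoint H)
    {z : ℂ} {c : ℝ} (hc : 0 < c) (h : ∀ u : H.domain, c * ‖(u : E)‖ ≤ ‖H u - z • (u : E)‖) :
    IsClosed ((subScalar H z).range : Set E) := by
  refine isClosed_of_closure_subset fun y hy => ?_
  obtain ⟨s, hs, hsy⟩ := mem_closure_iff_seq_limit.mp hy
  choose x hx using hs
  have hdiff : ∀ n m, c * ‖(x n : E) - x m‖ ≤ ‖s n - s m‖ := fun n m => by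
    have := h (x n - x m)
    rw [← subScalar_apply, map_sub, hx, hx] at this
    simpa using this
  have hcau : CauchySeq fun n => (x n : E) := by
    have hcs := hsy.cauchySeq
    rw [Metric.cauchySeq_iff] at hcs ⊢
    intro ε hε
    obtain ⟨N, hN⟩ := hcs (c * ε) (by positivity)
    refine ⟨N, fun m hm n hn => ?_⟩
    have h1 := hN m hm n hn
    have h2 := hdiff m n
    rw [dist_eq_norm] at h1 ⊢
    exact lt_of_mul_lt_mul_left (h2.trans_lt h1) hc.le
  obtain ⟨x₀, hx₀⟩ := cauchySeq_tendsto_of_complete hcau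
  have hHx : Tendsto (fun n => H (x n)) atTop (𝓝 (y + z • x₀)) := by
    have : (fun n => H (x n)) = fun n => s n + z • (x n : E) := by
      ext n
      rw [← hx n, subScalar_apply, sub_add_cancel]
    rw [this]
    exact hsy.add (hx₀.const_smul z)
  have hgraph : (x₀, y + z • x₀) ∈ (H.graph : Set (E × E)) :=
    hH.isClosed.mem_of_tendsto (hx₀.prodMk_nhds hHx)
      (Eventually.of_forall fun n => H.mem_graph (x n))
  obtain ⟨v, hv, hHv⟩ := (LinearPMap.mem_graph_iff H).mp hgraph
  refine ⟨v, ?_⟩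
  simp only at hv hHv
  rw [subScalar_apply, hHv, hv, add_sub_cancel_right]

/-- A vector orthogonal to the range lies in the domain of `H†`, with eigenvalue `conj z`; as `H† =
H`, the hypothesis `h'` makes it zero. -/
lemma orthogonal_range_subScalar [CompleteSpace E] {H : E →ₗ.[ℂ] E} (hH : IsSelfAdjoint H)
    {z : ℂ} (h' : ∀ u : H.domain, H u - conj z • (u : E) = 0 → (u : E) = 0) :
    (subScalar H z).rangeᗮ = ⊥ := by
  rw [Submodule.eq_bot_iff]
  intro y hy
  have hyx : ∀ x : H.domain, inner ℂ (conj z • y) (x : E) = inner ℂ y (H x) := fun x => by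
    have := (Submodule.mem_orthogonal' _ _).mp hy _ ⟨x, rfl⟩
    rw [subScalar_apply, inner_sub_right, inner_smul_right, sub_eq_zero] at this
    rw [inner_smul_left, this]
    simp
  have hdom : y ∈ H†.domain := LinearPMap.mem_adjoint_domain_of_exists y ⟨_, hyx⟩
  have hval : H† ⟨y, hdom⟩ = conj z • y :=
    LinearPMap.adjoint_apply_eq hH.dense_domain ⟨y, hdom⟩ hyx
  have hgraph : (y, conj z • y) ∈ H†.graph := (LinearPMap.mem_graph_iff _).mpr ⟨⟨y, hdom⟩, rfl, hval⟩
  rw [LinearPMap.isSelfAdjoint_def.mp hH] at hgraph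
  obtain ⟨v, hv, hHv⟩ := (LinearPMap.mem_graph_iff H).mp hgraph
  simp only at hv hHv
  rw [← hv]
  exact h' v (by rw [hHv, hv, sub_self])

theorem exists_resolvent_of_bounded_below [CompleteSpace E] {H : E →ₗ.[ℂ] E}
    (hH : IsSelfAdjoint H) {z : ℂ} {c : ℝ} (hc : 0 < c)
    (h : ∀ u : H.domain, c * ‖(u : E)‖ ≤ ‖H u - z • (u : E)‖)
    (h' : ∀ u : H.domain, H u - conj z • (u : E) = 0 → (u : E) = 0) :
    ∃ R : E →L[ℂ] E,
      (∀ w : E, ∃ h : R w ∈ H.domain, H ⟨R w, h⟩ - z • R w = w) ∧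
      ∀ u : H.domain, R (H u - z • (u : E)) = u := by
  have hinj : Function.Injective (subScalar H z) := by
    rw [← LinearMap.ker_eq_bot, LinearMap.ker_eq_bot']
    intro u hu
    have := h u
    rw [← subScalar_apply, hu, norm_zero] at this
    have h0 : ‖(u : E)‖ ≤ 0 := by nlinarith
    exact Subtype.ext (norm_le_zero_iff.mp h0)
  have hsurj : Function.Surjective (subScalar H z) := by
    have : CompleteSpace (subScalar H z).range :=
      (isClosed_range_subScalar hH hc h).completeSpace_coe
    rw [← LinearMap.range_eq_top, ← Submodule.orthogonal_eq_bot_iff]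
    exact orthogonal_range_subScalar hH h'
  let e := LinearEquiv.ofBijective (subScalar H z) ⟨hinj, hsurj⟩
  have he : ∀ w, H (e.symm w) - z • (e.symm w : E) = w := fun w => e.apply_symm_apply w
  refine ⟨(H.domain.subtype ∘ₗ e.symm.toLinearMap).mkContinuous c⁻¹ fun w => ?_,
    fun w => ⟨(e.symm w).2, he w⟩, fun u => ?_⟩
  · have := h (e.symm w)
    rw [he] at this
    rw [inv_mul_eq_div, le_div_iff₀ hc, mul_comm]
    exact this
  · exact congrArg Subtype.val (e.symm_apply_apply u)

lemma isFormalAdjoint_self [CompleteSpace E] {H : E →ₗ.[ℂ] E} (hH : IsSelfAdjoint H)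
    (x y : H.domain) : inner ℂ (H x) (y : E) = inner ℂ (x : E) (H y) := by
  have := LinearPMap.adjoint_isFormalAdjoint hH.dense_domain
  rw [LinearPMap.isSelfAdjoint_def.mp hH] at this
  exact this x y

lemma inner_apply_self_eq_quadForm [CompleteSpace E] {H : E →ₗ.[ℂ] E} (hH : IsSelfAdjoint H)
    (u : H.domain) : inner ℂ (H u) (u : E) = (quadForm H u : ℂ) := by
  refine (Complex.conj_eq_iff_re.mp ?_).symm
  rw [inner_conj_symm, isFormalAdjoint_self hH]

lemma norm_quadForm_sub_le [CompleteSpace E] {H : E →ₗ.[ℂ] E} (hH : IsSelfAdjoint H) (z : ℂ)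
    (u : H.domain) :
    ‖(quadForm H u : ℂ) - conj z * (‖(u : E)‖ : ℂ) ^ 2‖ ≤ ‖H u - z • (u : E)‖ * ‖(u : E)‖ := by
  have := norm_inner_le_norm (𝕜 := ℂ) (H u - z • (u : E)) (u : E)
  rwa [inner_sub_left, inner_smul_left, inner_apply_self_eq_quadForm hH,
    inner_self_eq_norm_sq_to_K] at this

/-- The numerical range lies in [0, ∞), so for `z` off this half-line Cauchy-Schwarz bounds `H - z`
from below. The same bound at `conj z` rules out a cokernel. -/
theorem nonneg_of_mem_operatorSpectrum [CompleteSpace E] {H : E →ₗ.[ℂ] E}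
    (hH : IsSelfAdjoint H) (hpos : IsNonnegOperator H) {z : ℂ} (hz : z ∈ operatorSpectrum H) :
    0 ≤ z.re ∧ z.im = 0 := by
  by_contra hcon
  obtain ⟨c, hc, hcz⟩ : ∃ c : ℝ, 0 < c ∧ ∀ w : ℂ, (w = z ∨ w = conj z) → ∀ q n : ℝ, 0 ≤ q →
      c * n ^ 2 ≤ ‖(q : ℂ) - conj w * (n : ℂ) ^ 2‖ := by
    by_cases him : z.im = 0
    · have hre : z.re < 0 := not_le.mp fun h => hcon ⟨h, him⟩
      refine ⟨-z.re, by linarith, fun w hw q n hq => ?_⟩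
      refine le_trans ?_ (Complex.re_le_norm _)
      have hwre : w.re = z.re := by rcases hw with rfl | rfl <;> simp
      have : (((q : ℂ) - conj w * (n : ℂ) ^ 2)).re = q - z.re * n ^ 2 := by
        rw [← Complex.ofReal_pow, Complex.sub_re, Complex.re_mul_ofReal]
        simp [hwre]
      rw [this]
      linarith
    · refine ⟨|z.im|, abs_pos.mpr him, fun w hw q n hq => ?_⟩
      refine le_trans (le_of_eq ?_) (Complex.abs_im_le_norm _)
      have hwim : |w.im| = |z.im| := by rcases hw with rfl | rfl <;> simp
      rw [← Complex.ofReal_pow, Complex.sub_im, Complex.im_mul_ofReal]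
      simp [abs_mul, hwim]
  have key : ∀ w : ℂ, (w = z ∨ w = conj z) → ∀ u : H.domain,
      c * ‖(u : E)‖ ≤ ‖H u - w • (u : E)‖ := fun w hw u => by
    rcases (norm_nonneg (u : E)).eq_or_lt with h0 | h0
    · rw [← h0, mul_zero]; exact norm_nonneg _
    · refine le_of_mul_le_mul_right ?_ h0
      calc c * ‖(u : E)‖ * ‖(u : E)‖ = c * ‖(u : E)‖ ^ 2 := by ring
        _ ≤ _ := hcz w hw (quadForm H u) ‖(u : E)‖ (hpos u)
        _ ≤ _ := norm_quadForm_sub_le hH w u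
  refine hz (exists_resolvent_of_bounded_below hH hc (key z (Or.inl rfl)) fun u hu => ?_)
  have := key _ (Or.inr rfl) u
  rw [hu, norm_zero] at this
  exact norm_le_zero_iff.mp (by nlinarith)

/-- `R` is the inverse of `H + 1`. -/
structure IsInverseAddOne (H : E →ₗ.[ℂ] E) (R : E →L[ℂ] E) : Prop where
  mem : ∀ w, R w ∈ H.domain
  apply : ∀ w, H ⟨R w, mem w⟩ = w - R w
  inv : ∀ u : H.domain, R (H u + u) = u

theorem exists_isInverseAddOne [CompleteSpace E] {H : E →ₗ.[ℂ] E}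
    (hH : IsSelfAdjoint H) (hpos : IsNonnegOperator H) : ∃ R, IsInverseAddOne H R := by
  have : (-1 : ℂ) ∉ operatorSpectrum H := fun h => by
    have := (nonneg_of_mem_operatorSpectrum hH hpos h).1
    norm_num at this
  obtain ⟨R, h1, h2⟩ := not_not.mp this
  refine ⟨R, fun w => (h1 w).1, fun w => ?_, fun u => ?_⟩
  · obtain ⟨h, hw⟩ := h1 w
    rw [neg_smul, one_smul, sub_neg_eq_add] at hw
    exact eq_sub_of_add_eq hw
  · simpa using h2 u

namespace IsInverseAddOne

variable {H : E →ₗ.[ℂ] E} {R : E →L[ℂ] E}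

theorem inv_sub_one_mem_operatorSpectrum (hR : IsInverseAddOne H R) {μ : ℂ} (h0 : μ ≠ 0)
    (hμ : μ ∈ spectrum ℂ R) : μ⁻¹ - 1 ∈ operatorSpectrum H := by
  rintro ⟨T, h1, h2⟩
  refine hμ ?_
  have e1 : ∀ g, T g = R g + μ⁻¹ • R (T g) := fun g => by
    obtain ⟨h, hg⟩ := h1 g
    have := hR.inv ⟨T g, h⟩
    rw [eq_add_of_sub_eq hg] at this
    simp only [map_add, map_smul, sub_smul, one_smul, map_sub] at this
    exact this.symm.trans (by module)
  have e2 : ∀ g, T g - μ⁻¹ • T (R g) = R g := fun g => by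
    have := h2 ⟨R g, hR.mem g⟩
    rw [hR.apply] at this
    simp only [map_smul, sub_smul, one_smul, map_sub] at this
    exact Eq.trans (by module) this
  -- With T = (H + 1 - μ⁻¹)⁻¹, the factorisation μ - R = μR(H + 1 - μ⁻¹) suggests the inverse μ⁻¹T(H
  -- + 1) = μ⁻¹(1 + μ⁻¹T). The identities `e1`, `e2` are the resolvent identity in its two orders.
  let S : E →L[ℂ] E := μ⁻¹ • (1 + μ⁻¹ • T)
  rw [spectrum.mem_resolventSet_iff, isUnit_iff_exists]
  refine ⟨S, ?_, ?_⟩ <;> ext g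
  · change algebraMap ℂ (E →L[ℂ] E) μ (S g) - R (S g) = g
    simp only [S, Algebra.algebraMap_eq_smul_one]
    change μ • μ⁻¹ • (g + μ⁻¹ • T g) - R (μ⁻¹ • (g + μ⁻¹ • T g)) = g
    rw [smul_inv_smul₀ h0, map_smul, map_add, map_smul]
    linear_combination (norm := module) μ⁻¹ • e1 g
  · change S (algebraMap ℂ (E →L[ℂ] E) μ g - R g) = g
    simp only [S, Algebra.algebraMap_eq_smul_one]
    change μ⁻¹ • (μ • g - R g + μ⁻¹ • T (μ • g - R g)) = g
    rw [map_sub, map_smul, smul_sub, inv_smul_smul₀ h0, smul_add, smul_sub, inv_smul_smul₀ h0]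
    linear_combination (norm := module) μ⁻¹ • e2 g

theorem isPositive [CompleteSpace E] (hH : IsSelfAdjoint H) (hpos : IsNonnegOperator H) (hR : IsInverseAddOne H R) :
    R.IsPositive := by
  have key : ∀ g, inner ℂ (R g) g = ((quadForm H ⟨R g, hR.mem g⟩ + ‖R g‖ ^ 2 : ℝ) : ℂ) := fun g => by
    have h1 : inner ℂ (R g) (H ⟨R g, hR.mem g⟩) = (quadForm H ⟨R g, hR.mem g⟩ : ℂ) := by
      rw [← inner_apply_self_eq_quadForm hH, isFormalAdjoint_self hH]
    have h2 : inner ℂ (R g) (R g) = ((‖R g‖ ^ 2 : ℝ) : ℂ) := by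
      rw [inner_self_eq_norm_sq_to_K]; simp
    rw [Complex.ofReal_add, ← h1, ← h2, hR.apply, ← inner_add_right, sub_add_cancel]
  rw [ContinuousLinearMap.isPositive_iff_complex]
  intro g
  rw [key]
  have := hpos ⟨R g, hR.mem g⟩
  refine ⟨by rw [RCLike.re_eq_complex_re, Complex.ofReal_re], ?_⟩
  rw [RCLike.re_eq_complex_re, Complex.ofReal_re]
  positivity

end IsInverseAddOne

theorem exists_mem_spectrum_norm_eq [CompleteSpace E] {R : E →L[ℂ] E} (hR : IsSelfAdjoint R)
    [Nontrivial E] : ∃ μ ∈ spectrum ℂ R, ‖μ‖ = ‖R‖ := by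
  obtain ⟨μ, hμ, h⟩ := spectrum.exists_nnnorm_eq_spectralRadius R
  refine ⟨μ, hμ, ?_⟩
  rw [hR.spectralRadius_eq_nnnorm] at h
  exact congrArg NNReal.toReal (ENNReal.coe_injective h)

/-- If σ(R) stayed farther than `κ'` from `μ`, the functional calculus would give R - μ an inverse
of norm at most `κ'⁻¹`, contradicting the defect `κ < κ'`. -/
theorem exists_mem_spectrum_of_approx [CompleteSpace E] {R : E →L[ℂ] E} (hR : IsSelfAdjoint R)
    {μ : ℂ} {u : E} (hu : u ≠ 0) {κ κ' : ℝ} (hκ : κ < κ') (hκ0 : 0 < κ')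
    (h : ‖R u - μ • u‖ ≤ κ * ‖u‖) : ∃ μ' ∈ spectrum ℂ R, ‖μ' - μ‖ ≤ κ' := by
  by_contra! hcon
  have hne : ∀ s ∈ spectrum ℂ R, s - μ ≠ 0 := fun s hs h0 => by
    have := hcon s hs
    rw [h0, norm_zero] at this
    linarith
  have hN : IsStarNormal R := hR.isStarNormal
  have hcont : ContinuousOn (fun s : ℂ => (s - μ)⁻¹) (spectrum ℂ R) :=
    (continuousOn_id.sub continuousOn_const).inv₀ hne
  have hmul : cfc (fun s : ℂ => (s - μ)⁻¹) R * (R - algebraMap ℂ _ μ) = 1 := by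
    have h1 : cfc (fun s : ℂ => s - μ) R = R - algebraMap ℂ _ μ := by
      rw [cfc_sub (fun s : ℂ => s) (fun _ => μ) R, cfc_id' ℂ R, cfc_const μ R]
    rw [← h1, ← cfc_mul _ _ R hcont, ← cfc_one ℂ R]
    exact cfc_congr fun s hs => inv_mul_cancel₀ (hne s hs)
  have hnorm : ‖cfc (fun s : ℂ => (s - μ)⁻¹) R‖ ≤ κ'⁻¹ :=
    norm_cfc_le (by positivity) fun s hs => by
      rw [norm_inv]
      exact inv_anti₀ hκ0 (hcon s hs).le
  have h2 : cfc (fun s : ℂ => (s - μ)⁻¹) R (R u - μ • u) = u := by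
    simpa [Algebra.algebraMap_eq_smul_one] using DFunLike.congr_fun hmul u
  have hu0 : 0 < ‖u‖ := norm_pos_iff.mpr hu
  have : ‖u‖ ≤ κ'⁻¹ * (κ * ‖u‖) := by
    calc ‖u‖ = _ := by rw [h2]
      _ ≤ _ := ContinuousLinearMap.le_opNorm _ _
      _ ≤ _ := by gcongr
  rw [inv_mul_eq_div, le_div_iff₀ hκ0] at this
  nlinarith

end Resolvent

/-! ### Polarisation of form bounds. -/

section BilinearForms

variable {V : Type*} [AddCommGroup V] [Module ℝ V]

/-- A symmetric bilinear form that is dominated on the diagonal by `δ A` is dominated off the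
diagonal as well. -/
theorem abs_apply_le_of_diag_le {A B : V →ₗ[ℝ] V →ₗ[ℝ] ℝ} (hA : ∀ x y, A x y = A y x)
    (hB : ∀ x y, B x y = B y x) {δ : ℝ} (hδ : 0 ≤ δ) (hA0 : ∀ x, 0 ≤ A x x)
    (h : ∀ x, |B x x| ≤ δ * A x x) (x y : V) : |B x y| ≤ δ * (√(A x x) * √(A y y)) := by
  -- Polarisation of `B` combined with the parallelogram law for `A`.
  have young : ∀ x y, |B x y| ≤ δ / 2 * (A x x + A y y) := fun x y => by
    have h1 := abs_le.mp (h (x + y))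
    have h2 := abs_le.mp (h (x - y))
    simp only [map_add, map_sub, LinearMap.add_apply, LinearMap.sub_apply, hB y x, hA y x] at h1 h2
    rw [abs_le]
    constructor <;> nlinarith
  have scaled : ∀ t : ℝ, 0 < t → |B x y| ≤ δ / 2 * (t ^ 2 * A x x + t⁻¹ ^ 2 * A y y) := fun t ht => by
    have := young (t • x) (t⁻¹ • y)
    simp only [map_smul, LinearMap.smul_apply, smul_eq_mul] at this
    rw [inv_mul_cancel_left₀ ht.ne'] at this
    refine this.trans (le_of_eq (by ring))
  set a := √(A x x) with ha
  set b := √(A y y) with hb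
  have ha0 : 0 ≤ a := Real.sqrt_nonneg _
  have hb0 : 0 ≤ b := Real.sqrt_nonneg _
  have ha2 : A x x = a ^ 2 := (Real.sq_sqrt (hA0 x)).symm
  have hb2 : A y y = b ^ 2 := (Real.sq_sqrt (hA0 y)).symm
  rw [ha2, hb2] at scaled
  -- The optimal scaling t² = b/a degenerates when a or b vanishes, so both are shifted by η, which
  -- then tends to 0.
  have perturbed : ∀ η : ℝ, 0 < η → |B x y| ≤ δ * ((a + η) * (b + η)) := fun η hη => by
    have hap : 0 < a + η := by positivity
    have hbp : 0 < b + η := by positivity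
    refine (scaled (√((b + η) / (a + η))) (by positivity)).trans ?_
    rw [inv_pow, Real.sq_sqrt (by positivity), inv_div]
    have h1 : (b + η) / (a + η) * a ^ 2 ≤ (a + η) * (b + η) := by
      rw [div_mul_eq_mul_div, div_le_iff₀ hap]
      have : a ^ 2 ≤ (a + η) ^ 2 := by gcongr; linarith
      nlinarith
    have h2 : (a + η) / (b + η) * b ^ 2 ≤ (a + η) * (b + η) := by
      rw [div_mul_eq_mul_div, div_le_iff₀ hbp]
      have : b ^ 2 ≤ (b + η) ^ 2 := by gcongr; linarith
      nlinarith
    nlinarith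
  have hlim : Tendsto (fun η : ℝ => δ * ((a + η) * (b + η))) (𝓝[>] 0) (𝓝 (δ * (a * b))) := by
    have : Continuous fun η : ℝ => δ * ((a + η) * (b + η)) := by fun_prop
    simpa using (this.tendsto 0).mono_left nhdsWithin_le_nhds
  exact ge_of_tendsto hlim (eventually_nhdsWithin_of_forall fun η hη => perturbed η hη)

end BilinearForms

/-! ### The form of H + 1 and weak approximate eigenvectors. -/

section ShiftedForm

variable {E : Type*} [NormedAddCommGroup E] [InnerProductSpace ℂ E]

/-- The real bilinear form `Re ((H + 1) x, y)` on the domain of `H`. -/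
noncomputable def shiftedForm (H : E →ₗ.[ℂ] E) : H.domain →ₗ[ℝ] H.domain →ₗ[ℝ] ℝ :=
  LinearMap.mk₂ ℝ (fun x y => (inner ℂ (H x + x) (y : E)).re)
    (fun x x' y => by
      rw [LinearPMap.map_add, Submodule.coe_add, add_add_add_comm, inner_add_left, Complex.add_re])
    (fun c x y => by
      have h1 : c • x = (c : ℂ) • x := Subtype.ext rfl
      rw [h1, LinearPMap.map_smul, Submodule.coe_smul, ← smul_add, inner_smul_left, Complex.conj_ofReal,
        Complex.re_ofReal_mul, smul_eq_mul])
    (fun x y y' => by rw [Submodule.coe_add, inner_add_right, Complex.add_re])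
    (fun c x y => by
      have h1 : c • y = (c : ℂ) • y := Subtype.ext rfl
      rw [h1, Submodule.coe_smul, inner_smul_right, Complex.re_ofReal_mul, smul_eq_mul])

/-- The real inner product, as a bilinear form on the domain of `H`. -/
noncomputable def domainInner (H : E →ₗ.[ℂ] E) : H.domain →ₗ[ℝ] H.domain →ₗ[ℝ] ℝ :=
  LinearMap.mk₂ ℝ (fun x y => (inner ℂ (x : E) (y : E)).re)
    (fun x x' y => by rw [Submodule.coe_add, inner_add_left, Complex.add_re])
    (fun c x y => by
      have h1 : c • x = (c : ℂ) • x := Subtype.ext rfl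
      rw [h1, Submodule.coe_smul, inner_smul_left]
      simp)
    (fun x y y' => by rw [Submodule.coe_add, inner_add_right, Complex.add_re])
    (fun c x y => by
      have h1 : c • y = (c : ℂ) • y := Subtype.ext rfl
      rw [h1, Submodule.coe_smul, inner_smul_right, Complex.re_ofReal_mul, smul_eq_mul])

variable {H : E →ₗ.[ℂ] E}

lemma shiftedForm_apply (x y : H.domain) :
    shiftedForm H x y = (inner ℂ (H x + x) (y : E)).re := rfl

lemma domainInner_apply (x y : H.domain) :
    domainInner H x y = (inner ℂ (x : E) (y : E)).re := rfl

lemma domainInner_self (x : H.domain) : domainInner H x x = ‖(x : E)‖ ^ 2 :=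
  inner_self_eq_norm_sq (𝕜 := ℂ) (x : E)

lemma shiftedForm_self (x : H.domain) :
    shiftedForm H x x = ‖(x : E)‖ ^ 2 + quadForm H x := by
  rw [shiftedForm_apply, inner_add_left, Complex.add_re, add_comm, ← domainInner_apply,
    domainInner_self, quadForm]

lemma shiftedForm_comm [CompleteSpace E] (hH : IsSelfAdjoint H) (x y : H.domain) :
    shiftedForm H x y = shiftedForm H y x := by
  rw [shiftedForm_apply, shiftedForm_apply, inner_add_left, inner_add_left,
    isFormalAdjoint_self hH, Complex.add_re, Complex.add_re]
  congr 1 <;> exact inner_re_symm (𝕜 := ℂ) _ _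

lemma domainInner_comm (x y : H.domain) : domainInner H x y = domainInner H y x :=
  inner_re_symm (𝕜 := ℂ) _ _

lemma shiftedForm_nonneg (hpos : IsNonnegOperator H) (x : H.domain) : 0 ≤ shiftedForm H x x := by
  rw [shiftedForm_self]
  have := hpos x
  positivity

lemma norm_le_sqrt_shiftedForm (hpos : IsNonnegOperator H) (x : H.domain) :
    ‖(x : E)‖ ≤ √(shiftedForm H x x) := by
  refine Real.le_sqrt_of_sq_le ?_
  rw [shiftedForm_self]
  linarith [hpos x]

lemma abs_shiftedForm_le [CompleteSpace E] (hH : IsSelfAdjoint H) (hpos : IsNonnegOperator H)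
    (x y : H.domain) :
    |shiftedForm H x y| ≤ √(shiftedForm H x x) * √(shiftedForm H y y) := by
  have := abs_apply_le_of_diag_le (shiftedForm_comm hH) (shiftedForm_comm hH) zero_le_one
    (shiftedForm_nonneg hpos)
    (fun x => by rw [abs_of_nonneg (shiftedForm_nonneg hpos x), one_mul]) x y
  rwa [one_mul] at this

lemma abs_domainInner_le (x y : H.domain) : |domainInner H x y| ≤ ‖(x : E)‖ * ‖(y : E)‖ :=
  (Complex.abs_re_le_norm _).trans (norm_inner_le_norm _ _)

lemma sqrt_shiftedForm_add_le [CompleteSpace E] (hH : IsSelfAdjoint H)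
    (hpos : IsNonnegOperator H) (x y : H.domain) :
    √(shiftedForm H (x + y) (x + y)) ≤ √(shiftedForm H x x) + √(shiftedForm H y y) := by
  refine Real.sqrt_le_iff.mpr ⟨by positivity, ?_⟩
  have h := le_of_abs_le (abs_shiftedForm_le hH hpos x y)
  rw [add_sq, Real.sq_sqrt (shiftedForm_nonneg hpos x), Real.sq_sqrt (shiftedForm_nonneg hpos y)]
  simp only [map_add, LinearMap.add_apply, shiftedForm_comm hH y x]
  linarith

lemma IsFormCore.exists_sqrt_lt {C : Submodule ℂ E} (hC : IsFormCore H C) (u : H.domain)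
    {η : ℝ} (hη : 0 < η) :
    ∃ v : H.domain, (v : E) ∈ C ∧ √(shiftedForm H (u - v) (u - v)) < η := by
  obtain ⟨v, hv, h⟩ := hC.2 u (η ^ 2) (by positivity)
  refine ⟨v, hv, ?_⟩
  rw [Real.sqrt_lt' hη, shiftedForm_self]
  exact h

/-- A bound for a linear functional on a form core holds on the whole domain, if the functional is
bounded for the form norm. -/
lemma IsFormCore.bound_of_bound [CompleteSpace E] (hH : IsSelfAdjoint H)
    (hpos : IsNonnegOperator H) {C : Submodule ℂ E} (hC : IsFormCore H C)
    (ψ : H.domain →ₗ[ℝ] ℝ) {K M : ℝ} (hM : 0 ≤ M)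
    (hψ : ∀ e, |ψ e| ≤ K * √(shiftedForm H e e))
    (h : ∀ e : H.domain, (e : E) ∈ C → |ψ e| ≤ M * √(shiftedForm H e e)) (e : H.domain) :
    |ψ e| ≤ M * √(shiftedForm H e e) := by
  -- The constant `K` multiplies only the approximation error, so it disappears in the limit.
  have key : ∀ η : ℝ, 0 < η → |ψ e| ≤ M * (√(shiftedForm H e e) + η) + |K| * η := fun η hη => by
    obtain ⟨v, hv, hev⟩ := hC.exists_sqrt_lt e hη
    have h1 : √(shiftedForm H v v) ≤ √(shiftedForm H e e) + η := by
      have := sqrt_shiftedForm_add_le hH hpos e (v - e)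
      rw [add_sub_cancel] at this
      have h2 : shiftedForm H (v - e) (v - e) = shiftedForm H (e - v) (e - v) := by
        rw [← neg_sub e v, map_neg, map_neg, LinearMap.neg_apply, neg_neg]
      rw [h2] at this
      linarith
    calc |ψ e| = |ψ v + ψ (e - v)| := by rw [← map_add, add_sub_cancel]
      _ ≤ |ψ v| + |ψ (e - v)| := abs_add_le _ _
      _ ≤ M * √(shiftedForm H v v) + K * √(shiftedForm H (e - v) (e - v)) :=
        add_le_add (h v hv) (hψ _)
      _ ≤ M * (√(shiftedForm H e e) + η) + |K| * η := by
        gcongr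
        exact le_abs_self K
  have hlim : Tendsto (fun η : ℝ => M * (√(shiftedForm H e e) + η) + |K| * η) (𝓝[>] 0)
      (𝓝 (M * √(shiftedForm H e e))) := by
    have : Continuous fun η : ℝ => M * (√(shiftedForm H e e) + η) + |K| * η := by fun_prop
    simpa using (this.tendsto 0).mono_left nhdsWithin_le_nhds
  exact ge_of_tendsto hlim (eventually_nhdsWithin_of_forall fun η hη => key η hη)

/-- Approximate eigenvectors in a form core: the weak form of Weyl's criterion. -/
theorem exists_approx_eigenvector [CompleteSpace E] (hH : IsSelfAdjoint H)
    (hpos : IsNonnegOperator H) {C : Submodule ℂ E} (hC : IsFormCore H C) {lam : ℝ}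
    (hlam : (lam : ℂ) ∈ operatorSpectrum H) {η : ℝ} (hη : 0 < η) :
    ∃ u : H.domain, (u : E) ∈ C ∧ (u : E) ≠ 0 ∧ ∀ e : H.domain,
      |shiftedForm H u e - (1 + lam) * domainInner H u e| ≤
        η * ‖(u : E)‖ * √(shiftedForm H e e) := by
  obtain ⟨w, hw⟩ : ∃ w : H.domain, ‖H w - (lam : ℂ) • (w : E)‖ < η / 4 * ‖(w : E)‖ := by
    by_contra! hcon
    refine hlam (exists_resolvent_of_bounded_below hH (by positivity) hcon fun u hu => ?_)
    have := hcon u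
    rw [Complex.conj_ofReal] at hu
    rw [hu, norm_zero] at this
    exact norm_le_zero_iff.mp (by nlinarith)
  have hw0 : 0 < ‖(w : E)‖ := by
    by_contra! h
    have := norm_nonneg (H w - (lam : ℂ) • (w : E))
    nlinarith
  set n := ‖(w : E)‖ with hn
  -- The first entry keeps ‖u‖ ≥ n/2; the second makes replacing w by u cost at most (η/4) n s, as
  -- much as the defect of w itself.
  set τ := min (n / 2) (η * n / (4 * (1 + |1 + lam|))) with hτ
  have hτ0 : 0 < τ := by positivity
  obtain ⟨u, huC, hu⟩ := hC.exists_sqrt_lt w hτ0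
  have hwu : ‖(w : E) - u‖ < τ := (norm_le_sqrt_shiftedForm hpos (w - u)).trans_lt hu
  have hnu : n / 2 ≤ ‖(u : E)‖ := by
    have h1 : τ ≤ n / 2 := min_le_left _ _
    have h2 := norm_sub_norm_le (w : E) u
    linarith
  refine ⟨u, huC, norm_pos_iff.mp (by linarith), fun e => ?_⟩
  set s := √(shiftedForm H e e)
  have hes : ‖(e : E)‖ ≤ s := norm_le_sqrt_shiftedForm hpos e
  have hs0 : 0 ≤ s := Real.sqrt_nonneg _
  have hA : |shiftedForm H w e - (1 + lam) * domainInner H w e| ≤ η / 4 * n * s := by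
    have : shiftedForm H w e - (1 + lam) * domainInner H w e =
        (inner ℂ (H w - (lam : ℂ) • (w : E)) (e : E)).re := by
      rw [shiftedForm_apply, domainInner_apply, inner_add_left, inner_sub_left, inner_smul_left,
        Complex.conj_ofReal, Complex.add_re, Complex.sub_re, Complex.re_ofReal_mul]
      ring
    rw [this]
    calc _ ≤ ‖inner ℂ (H w - (lam : ℂ) • (w : E)) (e : E)‖ := Complex.abs_re_le_norm _
      _ ≤ ‖H w - (lam : ℂ) • (w : E)‖ * ‖(e : E)‖ := norm_inner_le_norm _ _
      _ ≤ _ := by gcongr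
  have hB : |shiftedForm H (w - u) e| ≤ τ * s :=
    (abs_shiftedForm_le hH hpos _ _).trans (by gcongr)
  have hD : |domainInner H (w - u) e| ≤ τ * s :=
    (abs_domainInner_le _ _).trans (mul_le_mul hwu.le hes (norm_nonneg _) hτ0.le)
  have hτ2 : τ * (1 + |1 + lam|) ≤ η * n / 4 := by
    have h1 : τ ≤ η * n / (4 * (1 + |1 + lam|)) := min_le_right _ _
    rw [le_div_iff₀ (by positivity)] at h1
    linarith
  have hsplit : shiftedForm H u e - (1 + lam) * domainInner H u e =
      (shiftedForm H w e - (1 + lam) * domainInner H w e) - shiftedForm H (w - u) e +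
        (1 + lam) * domainInner H (w - u) e := by
    simp only [map_sub, LinearMap.sub_apply]
    ring
  rw [hsplit]
  calc _ ≤ |shiftedForm H w e - (1 + lam) * domainInner H w e| + |shiftedForm H (w - u) e| +
        |(1 + lam) * domainInner H (w - u) e| :=
        (abs_add_le _ _).trans (by gcongr; exact abs_sub _ _)
    _ ≤ η / 4 * n * s + τ * s + |1 + lam| * (τ * s) := by
        rw [abs_mul]
        gcongr
    _ = η / 4 * n * s + τ * (1 + |1 + lam|) * s := by ring
    _ ≤ η / 4 * n * s + η * n / 4 * s := by gcongr
    _ = η * (n / 2) * s := by ring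
    _ ≤ _ := by gcongr

end ShiftedForm

/-! ### Transfer of spectral values between close operators. -/

section SpectralComparison

variable {E₀ E₁ : Type*} [NormedAddCommGroup E₀] [InnerProductSpace ℂ E₀]
  [NormedAddCommGroup E₁] [InnerProductSpace ℂ E₁]

/-- A symmetric form of closeness: on the common core, either norm and either quadratic form is at
most `1 + δ` times the other one. -/
structure IsSymmClose (J : E₀ ≃ₗ[ℂ] E₁) (C : Submodule ℂ E₀)
    (H₀ : E₀ →ₗ.[ℂ] E₀) (H₁ : E₁ →ₗ.[ℂ] E₁) (δ : ℝ) : Prop where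
  norm_le : ∀ u ∈ C, ‖J u‖ ^ 2 ≤ (1 + δ) * ‖u‖ ^ 2
  le_norm : ∀ u ∈ C, ‖u‖ ^ 2 ≤ (1 + δ) * ‖J u‖ ^ 2
  form_le : ∀ (u₀ : H₀.domain) (u₁ : H₁.domain), (u₀ : E₀) ∈ C → J u₀ = u₁ →
    quadForm H₁ u₁ ≤ (1 + δ) * quadForm H₀ u₀
  le_form : ∀ (u₀ : H₀.domain) (u₁ : H₁.domain), (u₀ : E₀) ∈ C → J u₀ = u₁ →
    quadForm H₀ u₀ ≤ (1 + δ) * quadForm H₁ u₁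

variable {J : E₀ ≃ₗ[ℂ] E₁} {C : Submodule ℂ E₀} {H₀ : E₀ →ₗ.[ℂ] E₀} {H₁ : E₁ →ₗ.[ℂ] E₁}
  {ε δ : ℝ}

theorem IsSymmClose.symm (h : IsSymmClose J C H₀ H₁ δ) :
    IsSymmClose J.symm (C.map (J : E₀ →ₗ[ℂ] E₁)) H₁ H₀ δ where
  norm_le := by
    rintro _ ⟨u, hu, rfl⟩
    simpa using h.le_norm u hu
  le_norm := by
    rintro _ ⟨u, hu, rfl⟩
    simpa using h.norm_le u hu
  form_le u₁ u₀ := by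
    rintro ⟨u, hu, hJ⟩ hJ'
    rw [← hJ] at hJ'
    obtain rfl : u = u₀ := by simpa using hJ'
    exact h.le_form u₀ u₁ hu hJ
  le_form u₁ u₀ := by
    rintro ⟨u, hu, hJ⟩ hJ'
    rw [← hJ] at hJ'
    obtain rfl : u = u₀ := by simpa using hJ'
    exact h.form_le u₀ u₁ hu hJ

lemma IsSymmClose.shiftedForm_le (h : IsSymmClose J C H₀ H₁ δ) {u₀ : H₀.domain}
    {u₁ : H₁.domain} (hu : (u₀ : E₀) ∈ C) (hJ : J u₀ = u₁) :
    shiftedForm H₁ u₁ u₁ ≤ (1 + δ) * shiftedForm H₀ u₀ u₀ := by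
  rw [shiftedForm_self, shiftedForm_self, ← hJ, mul_add]
  exact add_le_add (h.norm_le _ hu) (h.form_le _ _ hu hJ)

lemma IsSymmClose.le_shiftedForm (h : IsSymmClose J C H₀ H₁ δ) {u₀ : H₀.domain}
    {u₁ : H₁.domain} (hu : (u₀ : E₀) ∈ C) (hJ : J u₀ = u₁) :
    shiftedForm H₀ u₀ u₀ ≤ (1 + δ) * shiftedForm H₁ u₁ u₁ := by
  rw [shiftedForm_self, shiftedForm_self, ← hJ, mul_add]
  exact add_le_add (h.le_norm _ hu) (h.le_form _ _ hu hJ)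

/-- R represents the inner product in the form of H + 1; this turns the weak eigenvector equation
into one for R. -/
lemma IsInverseAddOne.shiftedForm_left {H : E₀ →ₗ.[ℂ] E₀} {R : E₀ →L[ℂ] E₀}
    (hR : IsInverseAddOne H R) (u e : H.domain) :
    shiftedForm H ⟨R u, hR.mem u⟩ e = domainInner H u e := by
  rw [shiftedForm_apply, hR.apply, sub_add_cancel, domainInner_apply]

variable [CompleteSpace E₀] [CompleteSpace E₁]

/-- (1 + 2ε)(1 - ε) = 1 + ε(1 - 2ε) ≥ 1. -/
lemma le_one_add_mul_of_one_sub_mul_le {x y : ℝ} (hε : 0 < ε) (hε2 : ε < 1 / 2) (hx : 0 ≤ x)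
    (h : (1 - ε) * x ≤ y) : x ≤ (1 + 2 * ε) * y := by
  have h1 : (1 + 2 * ε) * ((1 - ε) * x) ≤ (1 + 2 * ε) * y := by gcongr
  have h2 : 0 ≤ ε * (1 - 2 * ε) * x := mul_nonneg (mul_nonneg hε.le (by linarith)) hx
  nlinarith

theorem IsEpsClose.isSymmClose (h : IsEpsClose J C H₀ H₁ ε) (hp : IsNonnegPair J C H₀ H₁)
    (hε : 0 < ε) (hε2 : ε < 1 / 2) : IsSymmClose J C H₀ H₁ (2 * ε) where
  norm_le u hu := (h.norm_le u hu).trans (by gcongr; linarith)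
  le_norm u hu := le_one_add_mul_of_one_sub_mul_le hε hε2 (by positivity) (h.le_norm u hu)
  form_le u₀ u₁ hu hJ := (h.form_le u₀ u₁ hu hJ).trans
    (mul_le_mul_of_nonneg_right (by linarith) (hp.nonneg₀ u₀))
  le_form u₀ u₁ hu hJ :=
    le_one_add_mul_of_one_sub_mul_le hε hε2 (hp.nonneg₀ u₀) (h.le_form u₀ u₁ hu hJ)

theorem IsNonnegPair.symm (hp : IsNonnegPair J C H₀ H₁) :
    IsNonnegPair J.symm (C.map (J : E₀ →ₗ[ℂ] E₁)) H₁ H₀ where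
  selfAdjoint₀ := hp.selfAdjoint₁
  selfAdjoint₁ := hp.selfAdjoint₀
  nonneg₀ := hp.nonneg₁
  nonneg₁ := hp.nonneg₀
  core₀ := hp.core₁
  core₁ := by
    have : (C.map (J : E₀ →ₗ[ℂ] E₁)).map (J.symm : E₁ →ₗ[ℂ] E₀) = C := by
      rw [← Submodule.map_comp]
      simp
    rw [this]
    exact hp.core₀

/-- The inclusion of the core in the domain of `H₀`. -/
noncomputable def IsNonnegPair.toDomain₀ (hp : IsNonnegPair J C H₀ H₁) : C →ₗ[ℝ] H₀.domain :=
  (Submodule.inclusion hp.core₀.1).restrictScalars ℝ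

/-- The restriction of `J` to the core, as a map to the domain of `H₁`. -/
noncomputable def IsNonnegPair.toDomain₁ (hp : IsNonnegPair J C H₀ H₁) : C →ₗ[ℝ] H₁.domain :=
  (((J : E₀ →ₗ[ℂ] E₁) ∘ₗ C.subtype).codRestrict H₁.domain
    fun u => hp.core₁.1 ⟨u, u.2, rfl⟩).restrictScalars ℝ

lemma abs_sub_le_mul_of_le {x y : ℝ} (hδ : 0 ≤ δ) (hx : 0 ≤ x) (h1 : y ≤ (1 + δ) * x)
    (h2 : x ≤ (1 + δ) * y) : |y - x| ≤ δ * x := by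
  have hy : 0 ≤ y := by
    by_contra! h
    nlinarith
  rw [abs_le]
  constructor
  · rcases le_total x y with h | h <;> nlinarith
  · linarith

lemma IsSymmClose.abs_shiftedForm_sub_le (h : IsSymmClose J C H₀ H₁ δ)
    (hp : IsNonnegPair J C H₀ H₁) (hδ : 0 ≤ δ) {u₀ e₀ : H₀.domain} {u₁ e₁ : H₁.domain}
    (hu : (u₀ : E₀) ∈ C) (he : (e₀ : E₀) ∈ C) (hJu : J u₀ = u₁) (hJe : J e₀ = e₁) :
    |shiftedForm H₁ u₁ e₁ - shiftedForm H₀ u₀ e₀| ≤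
      δ * (√(shiftedForm H₀ u₀ u₀) * √(shiftedForm H₀ e₀ e₀)) := by
  obtain rfl : hp.toDomain₁ ⟨u₀, hu⟩ = u₁ := Subtype.ext hJu
  obtain rfl : hp.toDomain₁ ⟨e₀, he⟩ = e₁ := Subtype.ext hJe
  have := abs_apply_le_of_diag_le (δ := δ)
    (A := (shiftedForm H₀).compl₁₂ hp.toDomain₀ hp.toDomain₀)
    (B := (shiftedForm H₁).compl₁₂ hp.toDomain₁ hp.toDomain₁ -
      (shiftedForm H₀).compl₁₂ hp.toDomain₀ hp.toDomain₀)
    (fun _ _ => shiftedForm_comm hp.selfAdjoint₀ _ _)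
    (fun _ _ => congrArg₂ (fun a b : ℝ => a - b) (shiftedForm_comm hp.selfAdjoint₁ _ _)
      (shiftedForm_comm hp.selfAdjoint₀ _ _))
    hδ (fun _ => shiftedForm_nonneg hp.nonneg₀ _)
    (fun x => abs_sub_le_mul_of_le hδ (shiftedForm_nonneg hp.nonneg₀ _)
      (h.shiftedForm_le x.2 rfl) (h.le_shiftedForm x.2 rfl))
    ⟨u₀, hu⟩ ⟨e₀, he⟩
  exact this

lemma IsSymmClose.abs_domainInner_sub_le (h : IsSymmClose J C H₀ H₁ δ)
    (hp : IsNonnegPair J C H₀ H₁) (hδ : 0 ≤ δ) {u₀ e₀ : H₀.domain} {u₁ e₁ : H₁.domain}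
    (hu : (u₀ : E₀) ∈ C) (he : (e₀ : E₀) ∈ C) (hJu : J u₀ = u₁) (hJe : J e₀ = e₁) :
    |domainInner H₁ u₁ e₁ - domainInner H₀ u₀ e₀| ≤ δ * (‖(u₀ : E₀)‖ * ‖(e₀ : E₀)‖) := by
  obtain rfl : hp.toDomain₁ ⟨u₀, hu⟩ = u₁ := Subtype.ext hJu
  obtain rfl : hp.toDomain₁ ⟨e₀, he⟩ = e₁ := Subtype.ext hJe
  have hsqrt : ∀ x : H₀.domain, √(domainInner H₀ x x) = ‖(x : E₀)‖ := fun x => by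
    rw [domainInner_self, Real.sqrt_sq (norm_nonneg _)]
  have := abs_apply_le_of_diag_le (δ := δ)
    (A := (domainInner H₀).compl₁₂ hp.toDomain₀ hp.toDomain₀)
    (B := (domainInner H₁).compl₁₂ hp.toDomain₁ hp.toDomain₁ -
      (domainInner H₀).compl₁₂ hp.toDomain₀ hp.toDomain₀)
    (fun _ _ => domainInner_comm _ _)
    (fun _ _ => congrArg₂ (fun a b : ℝ => a - b) (domainInner_comm _ _) (domainInner_comm _ _))
    hδ (fun x => by
      rw [LinearMap.compl₁₂_apply, domainInner_self]
      positivity)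
    (fun x => by
      rw [LinearMap.sub_apply, LinearMap.sub_apply, LinearMap.compl₁₂_apply,
        LinearMap.compl₁₂_apply, domainInner_self, domainInner_self]
      exact abs_sub_le_mul_of_le hδ (by positivity) (h.norm_le _ x.2) (h.le_norm _ x.2))
    ⟨u₀, hu⟩ ⟨e₀, he⟩
  rw [← hsqrt, ← hsqrt]
  exact this

/-- A spectral value of `H₁` yields an approximate eigenvector of `H₀`, in the weak sense. -/
theorem IsSymmClose.exists_approx_eigenvector (h : IsSymmClose J C H₀ H₁ δ)
    (hp : IsNonnegPair J C H₀ H₁) (hδ : 0 < δ) (hδ1 : δ ≤ 1) {lam : ℝ} (hlam0 : 0 ≤ lam)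
    (hlam : (lam : ℂ) ∈ operatorSpectrum H₁) :
    ∃ u : H₀.domain, (u : E₀) ≠ 0 ∧
      shiftedForm H₀ u u ≤ 12 * (1 + lam) * ‖(u : E₀)‖ ^ 2 ∧
      ∀ e : H₀.domain, |shiftedForm H₀ u e - (1 + lam) * domainInner H₀ u e| ≤
        9 * δ * (1 + lam) * ‖(u : E₀)‖ * √(shiftedForm H₀ e e) := by
  obtain ⟨u₁, ⟨c, hc, hcu⟩, hu₁, hW⟩ :=
    _root_.exists_approx_eigenvector hp.selfAdjoint₁ hp.nonneg₁ hp.core₁ hlam hδ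
  set m := 1 + lam with hm
  have hm1 : 1 ≤ m := by linarith
  obtain ⟨u, rfl⟩ : ∃ u : H₀.domain, (u : E₀) = c := ⟨⟨c, hp.core₀.1 hc⟩, rfl⟩
  have hJu : J u = u₁ := hcu
  set x := ‖(u : E₀)‖ with hx
  set n := ‖(u₁ : E₁)‖ with hn
  have hx0 : 0 ≤ x := norm_nonneg _
  have hn0 : 0 ≤ n := norm_nonneg _
  have hnx : n ^ 2 ≤ 2 * x ^ 2 := by
    have := h.norm_le u hc
    rw [hJu] at this
    nlinarith [sq_nonneg x]
  -- Testing the weak equation with u itself gives s² ≤ m n² + (n² + s²)/2, so s² ≤ 3m n²; passing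
  -- to H₀ costs a factor 2 for the form and 2 for the norm.
  have hupper : shiftedForm H₀ u u ≤ 12 * m * x ^ 2 := by
    have h1 := hW u₁
    rw [domainInner_self] at h1
    have hS := shiftedForm_nonneg hp.nonneg₁ u₁
    have h2 := (abs_le.mp h1).2
    have h3 := h.le_shiftedForm hc hJu
    have hs2 := Real.sq_sqrt hS
    have hs0 := Real.sqrt_nonneg (shiftedForm H₁ u₁ u₁)
    rw [← hs2] at h2 h3
    rw [Real.sqrt_sq hs0] at h2
    set s := √(shiftedForm H₁ u₁ u₁)
    have h4 : δ * n * s ≤ (n ^ 2 + s ^ 2) / 2 := by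
      have : δ * (n * s) ≤ 1 * (n * s) := by gcongr
      nlinarith [sq_nonneg (n - s)]
    have h5 : s ^ 2 ≤ 3 * m * n ^ 2 := by nlinarith [sq_nonneg n]
    have h6 : (1 + δ) * s ^ 2 ≤ 2 * s ^ 2 := by gcongr; linarith
    nlinarith
  refine ⟨u, fun h0 => hu₁ ?_, hupper, ?_⟩
  · rw [← hJu, h0, map_zero]
  have hsu : √(shiftedForm H₀ u u) ≤ 4 * m * x := by
    refine Real.sqrt_le_iff.mpr ⟨by positivity, hupper.trans ?_⟩
    nlinarith [mul_nonneg (mul_nonneg (by linarith : 0 ≤ m - 1) (by linarith : 0 ≤ m))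
      (sq_nonneg x), mul_nonneg (by linarith : 0 ≤ m) (sq_nonneg x)]
  refine fun e => hp.core₀.bound_of_bound hp.selfAdjoint₀ hp.nonneg₀
    (ψ := shiftedForm H₀ u - m • domainInner H₀ u) (K := √(shiftedForm H₀ u u) + m * x)
    (by positivity) (fun e => ?_) (fun e he => ?_) e
  · change |shiftedForm H₀ u e - m * domainInner H₀ u e| ≤ _
    have h1 := abs_shiftedForm_le hp.selfAdjoint₀ hp.nonneg₀ u e
    have h2 := (abs_domainInner_le u e).trans
      (mul_le_mul_of_nonneg_left (norm_le_sqrt_shiftedForm hp.nonneg₀ e) hx0)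
    calc _ ≤ |shiftedForm H₀ u e| + |m * domainInner H₀ u e| := abs_sub _ _
      _ ≤ √(shiftedForm H₀ u u) * √(shiftedForm H₀ e e) + m * (x * √(shiftedForm H₀ e e)) := by
        rw [abs_mul, abs_of_nonneg (by linarith : 0 ≤ m)]
        gcongr
      _ = _ := by ring
  · change |shiftedForm H₀ u e - m * domainInner H₀ u e| ≤ _
    obtain ⟨e₁, he₁⟩ : ∃ e₁ : H₁.domain, (e₁ : E₁) = J e :=
      ⟨⟨J e, hp.core₁.1 ⟨e, he, rfl⟩⟩, rfl⟩
    have h1 := h.abs_shiftedForm_sub_le hp hδ.le hc he hJu he₁.symm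
    have h2 := h.abs_domainInner_sub_le hp hδ.le hc he hJu he₁.symm
    have h3 := hW e₁
    have hes := norm_le_sqrt_shiftedForm hp.nonneg₀ e
    have hs1 : √(shiftedForm H₁ e₁ e₁) ≤ 2 * √(shiftedForm H₀ e e) := by
      refine Real.sqrt_le_iff.mpr ⟨by positivity, (h.shiftedForm_le he he₁.symm).trans ?_⟩
      rw [mul_pow, Real.sq_sqrt (shiftedForm_nonneg hp.nonneg₀ e)]
      have := shiftedForm_nonneg hp.nonneg₀ e
      gcongr
      linarith
    set s := √(shiftedForm H₀ e e)
    have hs0 : 0 ≤ s := Real.sqrt_nonneg _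
    have hn2 : n ≤ 2 * x := abs_le_of_sq_le_sq' (by nlinarith) (by positivity) |>.2
    have hsplit : shiftedForm H₀ u e - m * domainInner H₀ u e =
        (shiftedForm H₁ u₁ e₁ - m * domainInner H₁ u₁ e₁) -
          (shiftedForm H₁ u₁ e₁ - shiftedForm H₀ u e) +
          m * (domainInner H₁ u₁ e₁ - domainInner H₀ u e) := by ring
    rw [hsplit]
    calc _ ≤ |shiftedForm H₁ u₁ e₁ - m * domainInner H₁ u₁ e₁| +
          |shiftedForm H₁ u₁ e₁ - shiftedForm H₀ u e| +
          |m * (domainInner H₁ u₁ e₁ - domainInner H₀ u e)| :=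
          (abs_add_le _ _).trans (by gcongr; exact abs_sub _ _)
      -- The terms are the defect for H₁, the change of form and the change of inner product; 4 + 4m
      -- + m ≤ 9m as m ≥ 1.
      _ ≤ δ * (2 * x) * (2 * s) + δ * (4 * m * x * s) + m * (δ * (x * s)) := by
          rw [abs_mul, abs_of_nonneg (by linarith : 0 ≤ m)]
          gcongr
          · exact h3.trans (by gcongr)
          · exact h1.trans (by gcongr)
          · exact h2.trans (by gcongr)
      _ = (4 + 5 * m) * (δ * x * s) := by ring
      _ ≤ (9 * m) * (δ * x * s) := by gcongr; linarith
      _ = _ := by ring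

/-- Spectral values of `H₁` are close to spectral values of `H₀`, with an explicit bound. -/
theorem IsSymmClose.exists_mem_operatorSpectrum_near (h : IsSymmClose J C H₀ H₁ δ)
    (hp : IsNonnegPair J C H₀ H₁) (hδ : 0 < δ) (hδ1 : δ ≤ 1) {lam : ℝ} (hlam0 : 0 ≤ lam)
    (hlam : (lam : ℂ) ∈ operatorSpectrum H₁) :
    ∃ z ∈ operatorSpectrum H₀, ‖z - lam‖ ≤ 260 * δ * (1 + lam) ^ 2 := by
  obtain ⟨u, hu0, hupper, hu⟩ := h.exists_approx_eigenvector hp hδ hδ1 hlam0 hlam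
  obtain ⟨R, hR⟩ := exists_isInverseAddOne hp.selfAdjoint₀ hp.nonneg₀
  have hRsa : IsSelfAdjoint R := (hR.isPositive hp.selfAdjoint₀ hp.nonneg₀).isSelfAdjoint
  have hsub : ∀ μ : ℂ, μ⁻¹ - 1 - (lam : ℂ) = μ⁻¹ - ((1 + lam : ℝ) : ℂ) := fun μ => by
    push_cast; ring
  set m := 1 + lam with hm
  have hm1 : 1 ≤ m := by linarith
  have hm0 : 0 < m := by linarith
  set x := ‖(u : E₀)‖ with hx
  have hx0 : 0 < x := norm_pos_iff.mpr hu0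
  set v : H₀.domain := ⟨R u, hR.mem u⟩ with hv
  -- The first case keeps the spectral point of R away from 0. In the other, 1 < 20δm makes the
  -- claimed bound larger than 13m, so a crude spectral point suffices.
  by_cases hcase : 20 * δ * m ≤ 1
  · have happrox : ‖R u - ((m⁻¹ : ℝ) : ℂ) • (u : E₀)‖ ≤ 9 * δ * x := by
      -- With this test vector the left side of the weak equation becomes its own squared form norm.
      have h1 := hu (u - m • v)
      have h2 : shiftedForm H₀ u (u - m • v) - m * domainInner H₀ u (u - m • v) =
          shiftedForm H₀ (u - m • v) (u - m • v) := by
        rw [← hR.shiftedForm_left, map_sub (shiftedForm H₀), LinearMap.sub_apply, map_smul,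
          LinearMap.smul_apply, smul_eq_mul]
      have h3 := norm_le_sqrt_shiftedForm hp.nonneg₀ (u - m • v)
      have h4 := shiftedForm_nonneg hp.nonneg₀ (u - m • v)
      rw [h2, abs_of_nonneg h4, ← Real.sq_sqrt h4, Real.sqrt_sq (Real.sqrt_nonneg _), sq] at h1
      have h5 : √(shiftedForm H₀ (u - m • v) (u - m • v)) ≤ 9 * δ * m * x := by
        rcases (Real.sqrt_nonneg (shiftedForm H₀ (u - m • v) (u - m • v))).eq_or_lt with h0 | h0
        · rw [← h0]; positivity
        · exact le_of_mul_le_mul_right h1 h0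
      have h6 : R u - ((m⁻¹ : ℝ) : ℂ) • (u : E₀) =
          -(((m⁻¹ : ℝ) : ℂ) • ((u - m • v : H₀.domain) : E₀)) := by
        have : ((u - m • v : H₀.domain) : E₀) = (u : E₀) - (m : ℂ) • R u := rfl
        rw [this, smul_sub, smul_smul, ← Complex.ofReal_mul, inv_mul_cancel₀ hm0.ne',
          Complex.ofReal_one, one_smul, neg_sub]
      rw [h6, norm_neg, norm_smul, Complex.norm_real, Real.norm_of_nonneg (by positivity),
        inv_mul_eq_div, div_le_iff₀ hm0]
      linarith
    obtain ⟨μ, hμ, hμm⟩ := exists_mem_spectrum_of_approx hRsa hu0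
      (by linarith : 9 * δ < 10 * δ) (by positivity) happrox
    have hminv : 10 * δ ≤ m⁻¹ / 2 := by
      rw [le_div_iff₀ two_pos, ← one_div, le_div_iff₀ hm0]
      linarith
    have hμlow : m⁻¹ / 2 ≤ ‖μ‖ := by
      have h1 := norm_sub_norm_le ((m⁻¹ : ℝ) : ℂ) μ
      rw [norm_sub_rev, Complex.norm_real, Real.norm_of_nonneg (by positivity)] at h1
      linarith
    have hμpos : 0 < ‖μ‖ := lt_of_lt_of_le (by positivity) hμlow
    have hμ0 : μ ≠ 0 := norm_pos_iff.mp hμpos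
    refine ⟨_, hR.inv_sub_one_mem_operatorSpectrum hμ0 hμ, ?_⟩
    have hmC : (m : ℂ) ≠ 0 := Complex.ofReal_ne_zero.mpr hm0.ne'
    have heq : μ⁻¹ - 1 - (lam : ℂ) = -((m : ℂ) * μ⁻¹ * (μ - ((m⁻¹ : ℝ) : ℂ))) := by
      rw [hsub]
      push_cast
      field_simp
      ring
    rw [heq, norm_neg, norm_mul, norm_mul, norm_inv, Complex.norm_real, Real.norm_of_nonneg hm0.le]
    have hinv : ‖μ‖⁻¹ ≤ 2 * m := by
      rw [inv_le_comm₀ hμpos (by positivity), mul_inv]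
      linarith
    calc m * ‖μ‖⁻¹ * ‖μ - ((m⁻¹ : ℝ) : ℂ)‖ ≤ m * (2 * m) * (10 * δ) := by gcongr
      _ = 20 * δ * m ^ 2 := by ring
      _ ≤ 260 * δ * m ^ 2 := by gcongr; norm_num
  · have : Nontrivial E₀ := ⟨⟨u, 0, hu0⟩⟩
    obtain ⟨μ, hμ, hμR⟩ := exists_mem_spectrum_norm_eq hRsa
    -- Cauchy-Schwarz for the form: ‖u‖⁴ = a(Ru, u)² ≤ a(Ru, Ru) a(u, u), with a(Ru, Ru) = (u, Ru) ≤
    -- ‖R‖ ‖u‖².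
    have hnorm : 1 ≤ 12 * m * ‖R‖ := by
      have h1 := abs_shiftedForm_le hp.selfAdjoint₀ hp.nonneg₀ v u
      rw [hR.shiftedForm_left, domainInner_self, hR.shiftedForm_left, abs_of_nonneg (sq_nonneg _)]
        at h1
      have h2 : domainInner H₀ u v ≤ ‖R‖ * x ^ 2 := by
        calc _ ≤ x * ‖R u‖ := (le_abs_self _).trans (abs_domainInner_le u v)
          _ ≤ x * (‖R‖ * x) := by gcongr; exact R.le_opNorm _
          _ = _ := by ring
      have h3 : (x ^ 2) ^ 2 ≤ (‖R‖ * x ^ 2) * (12 * m * x ^ 2) := by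
        calc (x ^ 2) ^ 2 ≤ (√(‖R‖ * x ^ 2) * √(12 * m * x ^ 2)) ^ 2 := by
              gcongr
              exact h1.trans (by gcongr)
          _ = _ := by rw [mul_pow, Real.sq_sqrt (by positivity), Real.sq_sqrt (by positivity)]
      have hx4 : 0 < (x ^ 2) ^ 2 := by positivity
      nlinarith
    have hμpos : 0 < ‖μ‖ := by
      rw [hμR]
      by_contra! h0
      nlinarith [norm_nonneg R]
    refine ⟨_, hR.inv_sub_one_mem_operatorSpectrum (norm_pos_iff.mp hμpos) hμ, ?_⟩
    rw [hsub]
    have hinv : ‖μ‖⁻¹ ≤ 12 * m := by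
      rw [← one_div, div_le_iff₀ hμpos, hμR]
      exact hnorm
    push Not at hcase
    calc ‖μ⁻¹ - (m : ℂ)‖ ≤ ‖μ⁻¹‖ + ‖(m : ℂ)‖ := norm_sub_le _ _
      _ ≤ 12 * m + m := by
        rw [norm_inv, Complex.norm_real, Real.norm_of_nonneg hm0.le]
        gcongr
      _ = 13 * m * 1 := by ring
      _ ≤ 13 * m * (20 * δ * m) := by gcongr
      _ = _ := by ring

end SpectralComparison

/-! ### Pointed Gromov-Hausdorff distance of subsets of ℂ. -/

section PointedDistance

theorem pointedGHDist_le_of_isPointedGHNear {X Y : Type*} [MetricSpace X] [MetricSpace Y] {x : X}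
    {y : Y} {r : ℝ} (h : IsPointedGHNear X x Y y r) : pointedGHDist X x Y y ≤ r :=
  csInf_le ⟨0, fun _ hr => hr.1.le⟩ h

theorem isPointedGHNear_withBasePoint {S T : Set ℂ} {r : ℝ} (hr : 0 < r)
    (hST : ∀ z ∈ S, ‖z + 1‖ < 1 / r → ∃ w ∈ T, ‖z - w‖ < r)
    (hTS : ∀ w ∈ T, ‖w + 1‖ < 1 / r → ∃ z ∈ S, ‖z - w‖ < r) :
    IsPointedGHNear (WithBasePoint S) (basePoint S) (WithBasePoint T) (basePoint T) r := by
  refine ⟨hr, ℂ, inferInstance, Subtype.val, Subtype.val, isometry_subtype_coe,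
    isometry_subtype_coe, ?_, ?_, ?_⟩
  · change dist (-1 : ℂ) (-1) < r
    rwa [dist_self]
  · rintro ⟨z, rfl | hz⟩ hd
    · exact ⟨basePoint T, by change dist (-1 : ℂ) (-1) < r; rwa [dist_self]⟩
    · change dist z (-1) < 1 / r at hd
      rw [dist_eq_norm, sub_neg_eq_add] at hd
      obtain ⟨w, hw, h⟩ := hST z hz hd
      exact ⟨⟨w, Set.mem_insert_of_mem _ hw⟩, by simpa [dist_eq_norm] using h⟩
  · rintro ⟨w, rfl | hw⟩ hd
    · exact ⟨basePoint S, by change dist (-1 : ℂ) (-1) < r; rwa [dist_self]⟩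
    · change dist w (-1) < 1 / r at hd
      rw [dist_eq_norm, sub_neg_eq_add] at hd
      obtain ⟨z, hz, h⟩ := hTS w hw hd
      exact ⟨⟨z, Set.mem_insert_of_mem _ hz⟩, by simpa [dist_eq_norm] using h⟩

end PointedDistance

/-! ### Conclusion. -/

section Main

variable {E₀ E₁ : Type*} [NormedAddCommGroup E₀] [InnerProductSpace ℂ E₀] [CompleteSpace E₀]
  [NormedAddCommGroup E₁] [InnerProductSpace ℂ E₁] [CompleteSpace E₁]
  {J : E₀ ≃ₗ[ℂ] E₁} {C : Submodule ℂ E₀} {H₀ : E₀ →ₗ.[ℂ] E₀} {H₁ : E₁ →ₗ.[ℂ] E₁} {δ : ℝ}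

/-- In the ball of radius 1/r one has 1 + λ ≤ 1/r, so the error is at most 260δ/r² < r; this balance
dictates r of order δ^(1/3). -/
lemma IsSymmClose.exists_near_of_norm_lt (h : IsSymmClose J C H₀ H₁ δ)
    (hp : IsNonnegPair J C H₀ H₁) (hδ : 0 < δ) (hδ1 : δ ≤ 1) {r : ℝ} (hr : 0 < r)
    (hδr : 260 * δ < r ^ 3) {z : ℂ} (hz : z ∈ operatorSpectrum H₁) (hzr : ‖z + 1‖ < 1 / r) :
    ∃ w ∈ operatorSpectrum H₀, ‖w - z‖ < r := by
  obtain ⟨hre, him⟩ := nonneg_of_mem_operatorSpectrum hp.selfAdjoint₁ hp.nonneg₁ hz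
  have hzre : z = (z.re : ℂ) := Complex.ext rfl (by simpa using him)
  rw [hzre] at hz
  obtain ⟨w, hw, hwz⟩ := h.exists_mem_operatorSpectrum_near hp hδ hδ1 hre hz
  refine ⟨w, hw, ?_⟩
  rw [← hzre] at hwz
  have h1 : 1 + z.re ≤ 1 / r := by
    have := Complex.re_le_norm (z + 1)
    rw [Complex.add_re, Complex.one_re] at this
    linarith
  calc ‖w - z‖ ≤ 260 * δ * (1 + z.re) ^ 2 := hwz
    _ ≤ 260 * δ * (1 / r) ^ 2 := by gcongr
    _ < r ^ 3 * (1 / r) ^ 2 := by gcongr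
    _ = r := by field_simp

end Main

universe u v

theorem theorem3p4 :
    (∀ A : ℝ, 0 < A → ∃ c : ℝ, 0 < c ∧
      ∀ (E₀ : Type u) [NormedAddCommGroup E₀] [InnerProductSpace ℂ E₀] [CompleteSpace E₀]
        (E₁ : Type v) [NormedAddCommGroup E₁] [InnerProductSpace ℂ E₁] [CompleteSpace E₁]
        (J : E₀ ≃ₗ[ℂ] E₁) (C : Submodule ℂ E₀) (H₀ : E₀ →ₗ.[ℂ] E₀) (H₁ : E₁ →ₗ.[ℂ] E₁)
        (ε : ℝ), 0 < ε → ε < 1 / 2 →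
        IsNonnegPair J C H₀ H₁ → IsEpsClose J C H₀ H₁ ε →
        ∀ lam : ℝ, (lam : ℂ) ∈ operatorSpectrum H₁ → lam ∈ Set.Icc 0 A →
          Metric.infEDist (lam : ℂ) (operatorSpectrum H₀) <
            ENNReal.ofReal (c * ε ^ (1 / 3 : ℝ))) ∧
    (∃ ω : ℝ → ℝ, Tendsto ω (𝓝[>] 0) (𝓝 0) ∧
      ∀ (E₀ : Type u) [NormedAddCommGroup E₀] [InnerProductSpace ℂ E₀] [CompleteSpace E₀]
        (E₁ : Type v) [NormedAddCommGroup E₁] [InnerProductSpace ℂ E₁] [CompleteSpace E₁]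
        (J : E₀ ≃ₗ[ℂ] E₁) (C : Submodule ℂ E₀) (H₀ : E₀ →ₗ.[ℂ] E₀) (H₁ : E₁ →ₗ.[ℂ] E₁)
        (ε : ℝ), 0 < ε → ε < 1 / 2 →
        IsNonnegPair J C H₀ H₁ → IsEpsClose J C H₀ H₁ ε →
          spectralGHDist (operatorSpectrum H₀) (operatorSpectrum H₁) ≤ ω ε) := by
  constructor
  · intro A hA
    -- With δ = 2ε the bound has the factor 520; 521 makes the inequality strict, here and in `ω`.
    refine ⟨521 * (1 + A) ^ 2, by positivity, ?_⟩
    intro E₀ _ _ _ E₁ _ _ _ J C H₀ H₁ ε hε hε2 hp hc lam hlam hA'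
    obtain ⟨z, hz, hzl⟩ := (hc.isSymmClose hp hε hε2).exists_mem_operatorSpectrum_near hp
      (by linarith) (by linarith) hA'.1 hlam
    refine (Metric.infEDist_le_edist_of_mem hz).trans_lt ?_
    rw [edist_comm, edist_dist, dist_eq_norm, ENNReal.ofReal_lt_ofReal_iff (by positivity)]
    have hpow : ε ≤ ε ^ (1 / 3 : ℝ) := by
      have := Real.rpow_le_rpow_of_exponent_ge hε (by linarith) (by norm_num : (1 / 3 : ℝ) ≤ 1)
      rwa [Real.rpow_one] at this
    have h0 := hA'.1
    calc ‖z - lam‖ ≤ 260 * (2 * ε) * (1 + lam) ^ 2 := hzl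
      _ ≤ 260 * (2 * ε) * (1 + A) ^ 2 := by gcongr; exact hA'.2
      _ = 520 * (1 + A) ^ 2 * ε := by ring
      _ < 521 * (1 + A) ^ 2 * ε := by gcongr; norm_num
      _ ≤ _ := by gcongr
  · refine ⟨fun ε => (521 * ε) ^ (1 / 3 : ℝ), ?_, ?_⟩
    · have : Continuous fun ε : ℝ => (521 * ε) ^ (1 / 3 : ℝ) :=
        (Real.continuous_rpow_const (by norm_num)).comp (by fun_prop)
      have h0 := (this.tendsto 0).mono_left (nhdsWithin_le_nhds (s := Set.Ioi 0))
      simpa using h0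
    · intro E₀ _ _ _ E₁ _ _ _ J C H₀ H₁ ε hε hε2 hp hc
      have hs := hc.isSymmClose hp hε hε2
      have hr : 0 < (521 * ε) ^ (1 / 3 : ℝ) := by positivity
      have hr3 : 260 * (2 * ε) < ((521 * ε) ^ (1 / 3 : ℝ)) ^ 3 := by
        rw [← Real.rpow_natCast, ← Real.rpow_mul (by positivity)]
        norm_num
        linarith
      refine pointedGHDist_le_of_isPointedGHNear (isPointedGHNear_withBasePoint hr ?_ ?_)
      · intro z hz hzr
        obtain ⟨w, hw, h⟩ := hs.symm.exists_near_of_norm_lt hp.symm (by linarith) (by linarith)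
          hr hr3 hz hzr
        exact ⟨w, hw, by rwa [norm_sub_rev]⟩
      · intro w hw hwr
        exact hs.exists_near_of_norm_lt hp (by linarith) (by linarith) hr hr3 hw hwr
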